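/- \textbf{Conventions.} For a topological space $X$ write $x\le y$ iff $y\in\overline{\{x\}}$ (the dual of the specialisation order), and order maps pointwise. For continuous maps $f:X\to Y$, $g:Y\to X$ write $f\dashv g$ if $x\le g(f(x))$ for all $x\in X$ and $f(g(y))\le y$ for all $y\in Y$; two spaces are \emph{equivalent} if there are such $f,g$ with $gf(x)\le x\le gf(x)$ and $fg(y)\le y\le fg(y)$ for all $x,y$. Let $2=\{0,1\}$ be the Sierpiński space with $\{0\}$ open and $\{1\}$ closed. Let $X^{\mathrm{op}}$ be the set $UX$ of ultrafilters on $X$ whose closed sets are the subsets that are closed in the compact Hausdorff (Zariski) topology of $UX$ and down-closed for the order $\mathfrak x\le\mathfrak y\iff(\forall A\in\mathfrak x)\ \overline A\in\mathfrak y$. Let $PX=2^{X^{\mathrm{op}}}$ be the space of continuous maps $X^{\mathrm{op}}\to 2$ with the compact-open topology, and let $y_X:X\to PX$ be the Yoneda embedding, which sends $x$ to (the characteristic map of) the set of ultrafilters converging to $x$. The space $X$ is \emph{completely distributive} if there are continuous maps $\mathrm{Sup}_X:PX\to X$ and $t_X:X\to PX$ with $t_X\dashv \mathrm{Sup}_X\dashv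 y_X$. Let $\mathsf{Frm}_\wedge$ be the category of frames and maps preserving finite meets (including the top element), and let $\mathsf{CDTop}_{\inf}$ be the category of completely distributive $T_0$ spaces and continuous maps $f$ that have a left adjoint, that is, for which there is a continuous $g$ with $g\dashv f$. For a frame $L$ let $FL$ be the set of all (possibly improper) filters of $L$, topologised with the sets $x^\#=\{\mathfrak f\mid x\in\mathfrak f\}$ $(x\in L)$ as basic open sets, and for $f:L\to M$ in $\mathsf{Frm}_\wedge$ let $Ff:FL\to FM$ send $\mathfrak f$ to the up-closure of $\{f(x)\mid x\in\mathfrak f\}$. For $X$ in $\mathsf{CDTop}_{\inf}$ let $\Lambda(X)$ be the set of continuous maps $\varphi:X\to 2$ that are left adjoint (there is a continuous $r:2\to X$ with $\varphi\dashv r$), ordered pointwise, and put $\mathrm{Pt}(X)=\Lambda(X)^{\mathrm{op}}$; for $f:X\to Y$ in $\mathsf{CDTop}_{\inf}$ with left adjoint $g:Y\to X$ let $\mathrm{Pt}(f)$ send $\varphi$ to $\varphi\circ g$. \textbf{Theorem.} These assignments are functors $F:\mathsf{Frm}_\wedge\to\mathsf{CDTop}_{\inf}$ and $\mathrm{Pt}:\mathsf{CDTop}_{\inf}\to\mathsf{Frm}_\wedge$,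 and they define an equivalence of categories. Moreover, a topological space (not necessarily $T_0$) is equivalent to the filter space $FL$ of some frame $L$ if and only if it is completely distributive. -/

import Mathlib

open CategoryTheory Topology TopologicalSpace

universe u v w

namespace FilterDuality

/-! ## Order-enriched topology

The underlying order of a space is `x ≤ y` iff the principal ultrafilter at `x` converges to `y`,
i.e. `y ∈ closure {x}`; this is Mathlib's `x ⤳ y`. -/

/-- `f ⊣ g` for continuous maps, with respect to the underlying orders. -/
structure TopAdj {X : Type u} {Y : Type v} [TopologicalSpace X] [TopologicalSpace Y]
    (f : C(X, Y)) (g : C(Y, X)) : Prop where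
  unit : ∀ x, x ⤳ g (f x)
  counit : ∀ y, f (g y) ⤳ y

/-- Equivalence of spaces: continuous maps in both directions whose composites are equivalent to
the identities in the pointwise underlying order. For T₀ spaces this is homeomorphy. -/
def TopEquivalent (X : Type u) (Y : Type v) [TopologicalSpace X] [TopologicalSpace Y] : Prop :=
  ∃ (f : C(X, Y)) (g : C(Y, X)),
    (∀ x, Inseparable (g (f x)) x) ∧ ∀ y, Inseparable (f (g y)) y

/-- The underlying set of the Sierpiński space `2`. -/
inductive Two : Type
  | zero
  | one

/-- The order `0 ≤ 1`. -/
instance : PartialOrder Two where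
  le a b := a = Two.one → b = Two.one
  le_refl a h := h
  le_trans a b c h h' ha := h' (h ha)
  le_antisymm a b h h' := by cases a <;> cases b <;> simp_all

/-- In the Sierpiński space `2`, the point `0` is open and the point `1` is closed. Thus
continuous maps into `2` are the characteristic maps of closed sets. -/
instance : TopologicalSpace Two := generateFrom {{Two.zero}}

theorem continuous_two_iff {X : Type u} [TopologicalSpace X] {φ : X → Two} :
    Continuous φ ↔ IsOpen {x | φ x = Two.zero} := by
  rw [continuous_generateFrom_iff]
  simp only [Set.mem_singleton_iff, forall_eq]
  rfl

theorem isOpen_two_zero : IsOpen {a : Two | a = Two.zero} :=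
  continuous_two_iff.1 continuous_id

theorem TopAdj.comp {X : Type u} {Y : Type v} {Z : Type w} [TopologicalSpace X]
    [TopologicalSpace Y] [TopologicalSpace Z] {f : C(X, Y)} {g : C(Y, X)} {f' : C(Y, Z)}
    {g' : C(Z, Y)} (h : TopAdj f g) (h' : TopAdj f' g') : TopAdj (f'.comp f) (g.comp g') where
  unit x := (h.unit x).trans ((h'.unit (f x)).map g.continuous)
  counit z := ((h.counit (g' z)).map f'.continuous).trans (h'.counit z)

theorem TopAdj.specializes_iff {X : Type u} {Y : Type v} [TopologicalSpace X]
    [TopologicalSpace Y] {f : C(X, Y)} {g : C(Y, X)} (h : TopAdj f g) (x : X) (y : Y) :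
    f x ⤳ y ↔ x ⤳ g y :=
  ⟨fun k => (h.unit x).trans (k.map g.continuous), fun k => (k.map f.continuous).trans (h.counit y)⟩

theorem TopAdj.left_unique {X : Type u} {Y : Type v} [TopologicalSpace X] [TopologicalSpace Y]
    [T0Space Y] {f f' : C(X, Y)} {g : C(Y, X)} (h : TopAdj f g) (h' : TopAdj f' g) : f = f' := by
  ext x
  refine Inseparable.eq (Specializes.antisymm ?_ ?_)
  · exact (h.specializes_iff _ _).2 (h'.unit x)
  · exact (h'.specializes_iff _ _).2 (h.unit x)

open Classical in
/-- The truth value of a proposition, as a point of `2`. -/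
noncomputable def truth (p : Prop) : Two := if p then Two.one else Two.zero

theorem truth_eq_one {p : Prop} : truth p = Two.one ↔ p := by
  by_cases h : p <;> simp [truth, h]

theorem truth_eq_zero {p : Prop} : truth p = Two.zero ↔ ¬ p := by
  by_cases h : p <;> simp [truth, h]

theorem ne_one_iff {a : Two} : a ≠ Two.one ↔ a = Two.zero := by cases a <;> simp

theorem two_ext {a b : Two} (h : a = Two.one ↔ b = Two.one) : a = b := by
  cases a <;> cases b <;> simp_all

theorem two_specializes_iff {a b : Two} : a ⤳ b ↔ a ≤ b := by
  change _ ↔ (a = Two.one → b = Two.one)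
  constructor
  · intro h ha
    by_contra hb
    have := h.mem_open isOpen_two_zero (ne_one_iff.1 hb)
    simp_all
  · intro h
    rw [specializes_iff_pure, nhds_generateFrom, le_iInf₂_iff]
    rintro s ⟨hb, rfl⟩
    have hb' : b = Two.zero := hb
    have : a = Two.zero := by
      by_contra ha
      cases a <;> simp_all
    simp [this]

/-! ## The presheaf space `PX = 2 ^ (Xᵒᵖ)` and complete distributivity -/

/-- The dual space `Xᵒᵖ`. Its points are the ultrafilters on `X`. -/
def TopDual (X : Type u) : Type u := Ultrafilter X

/-- A point of `Xᵒᵖ` as an ultrafilter on `X`. -/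
def TopDual.ultra {X : Type u} (a : TopDual X) : Ultrafilter X := a

/-- The order on the ultrafilters of a space. -/
def UltraLE {X : Type u} [TopologicalSpace X] (a b : Ultrafilter X) : Prop :=
  ∀ A ∈ a, closure A ∈ b

/-- The topology of `Xᵒᵖ`: the space underlying the ordered compact Hausdorff space of
ultrafilters (with the Zariski topology) with the dual of the order `UltraLE`. Its closed sets
are the Zariski closed sets which are down-closed for `UltraLE`. -/
instance {X : Type u} [TopologicalSpace X] : TopologicalSpace (TopDual X) where
  IsOpen V := IsOpen (show Set (Ultrafilter X) from V) ∧
    ∀ a b : TopDual X, UltraLE a b → a ∈ V → b ∈ V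
  isOpen_univ := ⟨isOpen_univ (X := Ultrafilter X), fun _ _ _ _ => trivial⟩
  isOpen_inter s t hs ht := ⟨hs.1.inter ht.1, fun a b hab h =>
    ⟨hs.2 a b hab h.1, ht.2 a b hab h.2⟩⟩
  isOpen_sUnion S hS := ⟨isOpen_sUnion (X := Ultrafilter X) fun t ht => (hS t ht).1, by
    rintro a b hab ⟨t, ht, hat⟩
    exact ⟨t, ht, (hS t ht).2 a b hab hat⟩⟩

/-- `PX = 2 ^ (Xᵒᵖ)` with the compact-open topology. A point `ψ` of `PX` is identified with the
closed set of those ultrafilters `a` for which `ψ a = 1`. -/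
abbrev Presheaf (X : Type u) [TopologicalSpace X] : Type u := C(TopDual X, Two)

section
variable {X : Type u} [TopologicalSpace X]

/-- For a closed set `A`, the set of ultrafilters containing `A` is open in `Xᵒᵖ`. -/
theorem isOpen_dual {A : Set X} (hA : IsClosed A) : IsOpen {a : TopDual X | A ∈ a.ultra} := by
  refine ⟨ultrafilter_isOpen_basic A, fun a b hab ha => ?_⟩
  have := hab A ha
  rwa [hA.closure_eq] at this

theorem isOpen_not_conv : IsOpen {p : X × TopDual X | ¬ (p.2.ultra : Filter X) ≤ 𝓝 p.1} := by
  rw [isOpen_iff_mem_nhds]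
  rintro ⟨x, a⟩ h
  obtain ⟨V, hxV, hV, haV⟩ : ∃ V, x ∈ V ∧ IsOpen V ∧ V ∉ a.ultra := by
    by_contra! hc
    refine h fun s hs => ?_
    obtain ⟨V, hVs, hV, hxV⟩ := mem_nhds_iff.1 hs
    exact Filter.mem_of_superset (hc V hxV hV) hVs
  have hmem := prod_mem_nhds (hV.mem_nhds hxV)
    ((isOpen_dual hV.isClosed_compl).mem_nhds (x := a) (Ultrafilter.compl_mem_iff_notMem.2 haV))
  filter_upwards [hmem]
  rintro ⟨y, b⟩ ⟨hy, hb⟩ hc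
  exact Ultrafilter.compl_mem_iff_notMem.1 hb (hc (hV.mem_nhds hy))

/-- The Yoneda embedding `X → PX`, which sends `x` to the set of ultrafilters converging
to `x`. -/
noncomputable def yoneda (X : Type u) [TopologicalSpace X] : C(X, Presheaf X) :=
  ContinuousMap.curry
    { toFun := fun p : X × TopDual X => truth ((p.2.ultra : Filter X) ≤ 𝓝 p.1)
      continuous_toFun := by
        rw [continuous_two_iff]
        simp only [truth_eq_zero]
        exact isOpen_not_conv }

theorem yoneda_eq_one {x : X} {a : TopDual X} :
    yoneda X x a = Two.one ↔ (a.ultra : Filter X) ≤ 𝓝 x :=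
  truth_eq_one

/-- A space is completely distributive if it is cocomplete, i.e. the Yoneda embedding has a left
adjoint `Sup : PX → X`, and `Sup` in turn has a left adjoint `t : X → PX`. -/
def IsCompletelyDistributive (X : Type u) [TopologicalSpace X] : Prop :=
  ∃ S : C(Presheaf X, X), TopAdj S (yoneda X) ∧ ∃ t : C(X, Presheaf X), TopAdj t S

/-- The underlying order of `PX` is the inclusion of closed sets. -/
theorem presheaf_specializes_iff {ψ χ : Presheaf X} :
    ψ ⤳ χ ↔ ∀ a, ψ a = Two.one → χ a = Two.one := by
  rw [← ContinuousMap.specializes_coe, specializes_pi]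
  simp only [two_specializes_iff]
  rfl

/-- The set of ultrafilters containing a closed set `A` is compact in `Xᵒᵖ`. -/
theorem isCompact_dual (A : Set X) : IsCompact {a : TopDual X | A ∈ a.ultra} := by
  have hc : IsCompact {a : Ultrafilter X | A ∈ a} := (ultrafilter_isClosed_basic A).isCompact
  have hid : @Continuous (Ultrafilter X) (TopDual X) _ _ (fun a => a) :=
    ⟨fun s hs => hs.1⟩
  convert hc.image hid using 1
  exact (Set.image_id' {a : Ultrafilter X | A ∈ a}).symm

theorem isOpen_forall_mem (U : Set X) :
    IsOpen {ψ : Presheaf X | ∀ a, ψ a = Two.one → U ∈ a.ultra} := by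
  have := ContinuousMap.isOpen_setOfPred_mapsTo (isCompact_dual Uᶜ) isOpen_two_zero
  convert this using 1
  ext ψ
  refine forall_congr' fun a => ?_
  change (_ → _) ↔ (Uᶜ ∈ a.ultra → ψ a = Two.zero)
  rw [Ultrafilter.compl_mem_iff_notMem, ← ne_one_iff]
  tauto

/-- The closed set of ultrafilters containing an open set, as a point of `PX`. -/
noncomputable def openPresheaf (U : Set X) (hU : IsOpen U) : Presheaf X where
  toFun a := truth (U ∈ a.ultra)
  continuous_toFun := by
    rw [continuous_two_iff]
    simp only [truth_eq_zero, ← Ultrafilter.compl_mem_iff_notMem]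
    exact isOpen_dual hU.isClosed_compl

end

/-! ## Filter spaces -/

section Filters

open Order

variable {L : Type u} {M : Type v} [SemilatticeInf L] [OrderTop L] [SemilatticeInf M] [OrderTop M]

/-- The set of all filters containing `x`. -/
def sharp (x : L) : Set (PFilter L) := {F | x ∈ F}

/-- The filter space: the set of all (possibly improper) filters on a meet-semilattice, with the
sets `sharp x` as basic open sets. -/
instance filterTopology {L : Type u} [SemilatticeInf L] [OrderTop L] :
    TopologicalSpace (PFilter L) :=
  generateFrom (Set.range sharp)

theorem isOpen_sharp (x : L) : IsOpen (sharp x) := isOpen_generateFrom_of_mem ⟨x, rfl⟩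

theorem isTopologicalBasis_sharp : IsTopologicalBasis (Set.range (sharp (L := L))) where
  exists_subset_inter := by
    rintro _ ⟨x, rfl⟩ _ ⟨y, rfl⟩ F hF
    exact ⟨_, ⟨x ⊓ y, rfl⟩, PFilter.inf_mem hF.1 hF.2, fun G hG =>
      ⟨PFilter.mem_of_le inf_le_left hG, PFilter.mem_of_le inf_le_right hG⟩⟩
  sUnion_eq := Set.eq_univ_of_forall fun F => ⟨_, ⟨⊤, rfl⟩, PFilter.top_mem⟩
  eq_generateFrom := rfl

theorem isOpen_filters_iff {A : Set (PFilter L)} :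
    IsOpen A ↔ ∀ F ∈ A, ∃ x ∈ F, sharp x ⊆ A := by
  rw [isTopologicalBasis_sharp.isOpen_iff]
  refine forall₂_congr fun F _ => ?_
  simp only [Set.exists_range_iff]
  rfl

theorem le_nhds_filter_iff {l : Filter (PFilter L)} {F : PFilter L} :
    l ≤ 𝓝 F ↔ ∀ x ∈ F, sharp x ∈ l := by
  rw [isTopologicalBasis_sharp.nhds_hasBasis.ge_iff]
  simp only [and_imp, Set.forall_mem_range]
  rfl

theorem filter_specializes_iff {F G : PFilter L} : F ⤳ G ↔ G ≤ F := by
  rw [specializes_iff_pure, le_nhds_filter_iff]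
  rfl

instance : T0Space (PFilter L) where
  t0 _ _ h := le_antisymm (filter_specializes_iff.1 h.specializes')
    (filter_specializes_iff.1 h.specializes)

/-- The map of filter spaces `F f` sending a filter to the upward closure of its image. -/
def filterMap (f : InfTopHom L M) : C(PFilter L, PFilter M) where
  toFun F := IsPFilter.toPFilter (F := {y | ∃ x ∈ F, f x ≤ y}) <| by
    refine IsPFilter.of_def ⟨⊤, ⊤, PFilter.top_mem, le_top⟩ ?_ ?_
    · rintro y ⟨x, hx, hxy⟩ y' ⟨x', hx', hxy'⟩
      refine ⟨y ⊓ y', ⟨x ⊓ x', PFilter.inf_mem hx hx', ?_⟩, inf_le_left, inf_le_right⟩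
      rw [map_inf]
      exact inf_le_inf hxy hxy'
    · rintro y y' h ⟨x, hx, hxy⟩
      exact ⟨x, hx, hxy.trans h⟩
  continuous_toFun := by
    refine continuous_generateFrom_iff.2 ?_
    rintro _ ⟨y, rfl⟩
    rw [isOpen_filters_iff]
    rintro F ⟨x, hx, hxy⟩
    exact ⟨x, hx, fun G hG => ⟨x, hG, hxy⟩⟩

theorem mem_filterMap {f : InfTopHom L M} {F : PFilter L} {y : M} :
    y ∈ filterMap f F ↔ ∃ x ∈ F, f x ≤ y :=
  Iff.rfl

/-- The inverse image map of filter spaces. -/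
def filterComap (f : InfTopHom L M) : C(PFilter M, PFilter L) where
  toFun G := IsPFilter.toPFilter (F := {x | f x ∈ G}) <| by
    refine IsPFilter.of_def ⟨⊤, ?_⟩ ?_ ?_
    · change f ⊤ ∈ G
      rw [map_top]
      exact PFilter.top_mem
    · intro x hx y hy
      refine ⟨x ⊓ y, ?_, inf_le_left, inf_le_right⟩
      change f (x ⊓ y) ∈ G
      rw [map_inf]
      exact PFilter.inf_mem hx hy
    · intro x y h hx
      exact PFilter.mem_of_le (OrderHomClass.mono f h) hx
  continuous_toFun := by
    refine continuous_generateFrom_iff.2 ?_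
    rintro _ ⟨x, rfl⟩
    exact isOpen_sharp (f x)

theorem mem_filterComap {f : InfTopHom L M} {G : PFilter M} {x : L} :
    x ∈ filterComap f G ↔ f x ∈ G :=
  Iff.rfl

theorem filterComap_adj_filterMap (f : InfTopHom L M) : TopAdj (filterComap f) (filterMap f) where
  unit G := by
    rw [filter_specializes_iff]
    rintro y ⟨x, hx, hxy⟩
    exact PFilter.mem_of_le hxy hx
  counit F := by
    rw [filter_specializes_iff]
    intro x hx
    exact ⟨x, hx, le_rfl⟩

theorem filterMap_id (L : Type u) [SemilatticeInf L] [OrderTop L] :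
    filterMap (InfTopHom.id L) = ContinuousMap.id (PFilter L) := by
  ext F x
  constructor
  · rintro ⟨y, hy, hyx⟩
    exact PFilter.mem_of_le hyx hy
  · intro hx
    exact ⟨x, hx, le_rfl⟩

theorem filterMap_comp {N : Type w} [SemilatticeInf N] [OrderTop N] (g : InfTopHom M N)
    (f : InfTopHom L M) : filterMap (g.comp f) = (filterMap g).comp (filterMap f) := by
  ext F z
  constructor
  · rintro ⟨x, hx, hxz⟩
    exact ⟨f x, ⟨x, hx, le_rfl⟩, hxz⟩
  · rintro ⟨y, ⟨x, hx, hxy⟩, hyz⟩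
    exact ⟨x, hx, (OrderHomClass.mono g hxy).trans hyz⟩

/-! ### The presheaf space as the filter space of the frame of open sets -/

section
variable {X : Type u} [TopologicalSpace X]

/-- The filter of the open sets contained in all members of a closed set of ultrafilters. -/
def toFilter (X : Type u) [TopologicalSpace X] : C(Presheaf X, PFilter (Opens X)) where
  toFun ψ := IsPFilter.toPFilter (F := {U | ∀ a, ψ a = Two.one → (U : Set X) ∈ a.ultra}) <| by
    refine IsPFilter.of_def ⟨⊤, fun a _ => Filter.univ_mem⟩ ?_ ?_
    · intro U hU V hV
      exact ⟨U ⊓ V, fun a ha => Filter.inter_mem (hU a ha) (hV a ha), inf_le_left, inf_le_right⟩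
    · intro U V h hU a ha
      exact Filter.mem_of_superset (hU a ha) h
  continuous_toFun := by
    refine continuous_generateFrom_iff.2 ?_
    rintro _ ⟨U, rfl⟩
    exact isOpen_forall_mem (U : Set X)

theorem mem_toFilter {ψ : Presheaf X} {U : Opens X} :
    U ∈ toFilter X ψ ↔ ∀ a, ψ a = Two.one → (U : Set X) ∈ a.ultra :=
  Iff.rfl

/-- The closed set of the ultrafilters containing a given filter of open sets. -/
noncomputable def ofFilter (X : Type u) [TopologicalSpace X] :
    C(PFilter (Opens X), Presheaf X) :=
  ContinuousMap.curry
    { toFun := fun p : PFilter (Opens X) × TopDual X =>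
        truth (∀ U ∈ p.1, (U : Set X) ∈ p.2.ultra)
      continuous_toFun := by
        rw [continuous_two_iff, isOpen_iff_mem_nhds]
        rintro ⟨F, a⟩ h
        obtain ⟨U, hU, haU⟩ : ∃ U ∈ F, (U : Set X) ∉ a.ultra := by
          simpa [truth_eq_zero] using h
        have hmem := prod_mem_nhds ((isOpen_sharp U).mem_nhds hU)
          ((isOpen_dual U.isOpen.isClosed_compl).mem_nhds (x := a)
            (Ultrafilter.compl_mem_iff_notMem.2 haU))
        filter_upwards [hmem]
        rintro ⟨G, b⟩ ⟨hG, hb⟩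
        exact truth_eq_zero.2 fun hc => Ultrafilter.compl_mem_iff_notMem.1 hb (hc U hG) }

theorem ofFilter_eq_one {F : PFilter (Opens X)} {a : TopDual X} :
    ofFilter X F a = Two.one ↔ ∀ U ∈ F, (U : Set X) ∈ a.ultra :=
  truth_eq_one

theorem toFilter_ofFilter (F : PFilter (Opens X)) : toFilter X (ofFilter X F) = F := by
  ext U
  change (∀ a, ofFilter X F a = Two.one → (U : Set X) ∈ a.ultra) ↔ U ∈ F
  simp only [ofFilter_eq_one]
  refine ⟨fun h => ?_, fun hU a ha => ha U hU⟩
  by_contra hU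
  let l : Filter X :=
    { sets := {s | ∃ V ∈ F, (V : Set X) ⊆ s}
      univ_sets := ⟨⊤, PFilter.top_mem, Set.subset_univ _⟩
      sets_of_superset := by
        rintro s t ⟨V, hV, hVs⟩ hst
        exact ⟨V, hV, hVs.trans hst⟩
      inter_sets := by
        rintro s t ⟨V, hV, hVs⟩ ⟨W, hW, hWt⟩
        exact ⟨V ⊓ W, PFilter.inf_mem hV hW, Set.inter_subset_inter hVs hWt⟩ }
  have hne : Filter.NeBot (l ⊓ Filter.principal (U : Set X)ᶜ) := by
    rw [Filter.inf_principal_neBot_iff]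
    rintro s ⟨V, hV, hVs⟩
    by_contra hc
    rw [Set.not_nonempty_iff_eq_empty, ← Set.disjoint_iff_inter_eq_empty,
      Set.disjoint_compl_right_iff_subset] at hc
    exact hU (PFilter.mem_of_le (show V ≤ U from hVs.trans hc) hV)
  let a : Ultrafilter X := Ultrafilter.of (l ⊓ Filter.principal (U : Set X)ᶜ)
  have hle : (a : Filter X) ≤ l ⊓ Filter.principal (U : Set X)ᶜ := Ultrafilter.of_le _
  have h1 : (U : Set X) ∈ a := h a fun V hV =>
    (hle.trans inf_le_left) (show (V : Set X) ∈ l from ⟨V, hV, subset_rfl⟩)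
  have h2 : (U : Set X)ᶜ ∈ a := (hle.trans inf_le_right) (Filter.mem_principal_self _)
  exact Ultrafilter.compl_mem_iff_notMem.1 h2 h1

theorem ofFilter_toFilter (ψ : Presheaf X) : ofFilter X (toFilter X ψ) = ψ := by
  ext a
  refine two_ext ?_
  rw [ofFilter_eq_one]
  refine ⟨fun h => ?_, fun ha U hU => hU a ha⟩
  by_contra ha
  have hψ : IsOpen {b : TopDual X | ψ b = Two.zero} := continuous_two_iff.1 ψ.continuous
  let K : Set (Ultrafilter X) := {b | ψ b = Two.one}
  have hK : IsCompact K := by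
    refine IsClosed.isCompact ⟨?_⟩
    convert! hψ.1 using 1
    ext b
    exact ne_one_iff
  have hex : ∀ b ∈ K, ∃ A ∈ a.ultra, closure A ∉ b := by
    intro b hb
    by_contra! hc
    have h0 : ψ b = Two.zero := hψ.2 a b hc (ne_one_iff.1 ha)
    have h1 : ψ b = Two.one := hb
    rw [h0] at h1
    exact Two.noConfusion h1
  choose! A hA hAb using hex
  obtain ⟨s, hsK, hs⟩ := hK.elim_nhds_subcover (fun b => {c : Ultrafilter X | (closure (A b))ᶜ ∈ c})
    fun b hb => (ultrafilter_isOpen_basic _).mem_nhds (Ultrafilter.compl_mem_iff_notMem.2 (hAb b hb))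
  let B : Set X := ⋂ b ∈ s, A b
  have hB : B ∈ a.ultra := (Filter.biInter_finset_mem s).2 fun b hb => hA b (hsK b hb)
  have hO := h ⟨(closure B)ᶜ, isClosed_closure.isOpen_compl⟩ fun c hc => by
    obtain ⟨b, hb, hcb⟩ := Set.mem_iUnion₂.1 (hs (show c ∈ K from hc))
    refine Filter.mem_of_superset hcb (Set.compl_subset_compl.2 (closure_mono ?_))
    exact Set.biInter_subset_of_mem hb
  exact Ultrafilter.compl_mem_iff_notMem.1 hO (Filter.mem_of_superset hB subset_closure)

theorem toFilter_adj : TopAdj (toFilter X) (ofFilter X) where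
  unit ψ := specializes_of_eq (ofFilter_toFilter ψ).symm
  counit F := specializes_of_eq (toFilter_ofFilter F)

theorem ofFilter_adj : TopAdj (ofFilter X) (toFilter X) where
  unit F := specializes_of_eq (toFilter_ofFilter F).symm
  counit ψ := specializes_of_eq (ofFilter_toFilter ψ)

end

/-! ### Filter spaces of frames are completely distributive -/

/-- The map `x ↦ sharp x`. -/
def alpha (L : Type u) [SemilatticeInf L] [OrderTop L] : InfTopHom L (Opens (PFilter L)) where
  toFun x := ⟨sharp x, isOpen_sharp x⟩
  map_inf' x y := by
    ext F
    exact PFilter.inf_mem_iff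
  map_top' := by
    ext F
    exact iff_of_true PFilter.top_mem trivial

/-- The left adjoint of `alpha`. -/
def beta (L : Type u) [Order.Frame L] : InfTopHom (Opens (PFilter L)) L where
  toFun A := sSup {y | sharp y ⊆ A}
  map_inf' A B := by
    refine le_antisymm (le_inf ?_ ?_) ?_
    · exact sSup_le_sSup fun y hy => hy.trans Set.inter_subset_left
    · exact sSup_le_sSup fun y hy => hy.trans Set.inter_subset_right
    · rw [sSup_inf_sSup]
      refine iSup₂_le fun p hp => le_sSup fun F hF => ?_
      have hF' := PFilter.inf_mem_iff.1 (show p.1 ⊓ p.2 ∈ F from hF)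
      exact ⟨hp.1 hF'.1, hp.2 hF'.2⟩
  map_top' := top_le_iff.1 (le_sSup fun _ _ => trivial)

theorem beta_alpha_le {L : Type u} [Order.Frame L] (x : L) : beta L (alpha L x) ≤ x :=
  sSup_le fun y hy => by
    have h : PFilter.principal y ∈ sharp x := hy (show y ∈ PFilter.principal y from le_rfl)
    exact h

theorem le_alpha_beta {L : Type u} [Order.Frame L] (A : Opens (PFilter L)) :
    A ≤ alpha L (beta L A) := by
  intro F hF
  obtain ⟨x, hx, hxA⟩ := isOpen_filters_iff.1 A.isOpen F hF
  exact PFilter.mem_of_le (le_sSup hxA) hx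

theorem filterMap_beta_adj {L : Type u} [Order.Frame L] :
    TopAdj (filterMap (beta L)) (filterMap (alpha L)) where
  unit F := by
    rw [filter_specializes_iff]
    rintro A ⟨x, ⟨B, hB, hBx⟩, hxA⟩
    exact PFilter.mem_of_le
      ((le_alpha_beta B).trans ((OrderHomClass.mono (alpha L) hBx).trans hxA)) hB
  counit G := by
    rw [filter_specializes_iff]
    intro x hx
    exact ⟨alpha L x, ⟨x, hx, le_rfl⟩, beta_alpha_le x⟩

theorem yoneda_filter (L : Type u) [SemilatticeInf L] [OrderTop L] :
    yoneda (PFilter L) = (ofFilter (PFilter L)).comp (filterMap (alpha L)) := by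
  ext F a
  refine two_ext ?_
  rw [yoneda_eq_one, le_nhds_filter_iff, ContinuousMap.comp_apply, ofFilter_eq_one]
  constructor
  · rintro h A ⟨x, hx, hxA⟩
    exact Filter.mem_of_superset (h x hx) hxA
  · intro h x hx
    exact h (alpha L x) ⟨x, hx, le_rfl⟩

theorem filter_isCompletelyDistributive (L : Type u) [Order.Frame L] :
    IsCompletelyDistributive (PFilter L) := by
  refine ⟨(filterMap (beta L)).comp (toFilter _), ?_, (ofFilter _).comp (filterComap (beta L)), ?_⟩
  · rw [yoneda_filter]
    exact toFilter_adj.comp filterMap_beta_adj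
  · exact (filterComap_adj_filterMap (beta L)).comp ofFilter_adj

end Filters

/-! ## Left adjoint maps into the Sierpiński space -/

section Lambda

variable {X : Type u} {Y : Type v} [TopologicalSpace X] [TopologicalSpace Y]

/-- `Λ(X)`: the set of all left adjoint continuous maps `X → 2`. -/
def Lambda (X : Type u) [TopologicalSpace X] : Type u :=
  {φ : C(X, Two) // ∃ r : C(Two, X), TopAdj φ r}

/-- The pointwise order on `Λ(X)`. -/
instance : PartialOrder (Lambda X) :=
  PartialOrder.lift (fun φ => (φ.1 : X → Two)) fun _ _ h => Subtype.ext (DFunLike.coe_injective h)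

/-- The continuous map from the Sierpiński space given by two points `x ≤ y`. -/
def twoMap (x y : X) (h : x ⤳ y) : C(Two, X) where
  toFun
    | Two.zero => x
    | Two.one => y
  continuous_toFun := by
    refine continuous_def.2 fun V hV => ?_
    by_cases hy : y ∈ V
    · convert isOpen_univ
      refine Set.eq_univ_of_forall fun a => ?_
      cases a
      · exact h.mem_open hV hy
      · exact hy
    · by_cases hx : x ∈ V
      · convert isOpen_two_zero
        ext a
        cases a
        · exact iff_of_true hx rfl
        · exact iff_of_false hy (fun h => Two.noConfusion h)
      · convert isOpen_empty
        refine Set.eq_empty_of_forall_notMem fun a => ?_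
        cases a
        · exact hx
        · exact hy

/-- The open set on which an element of `Λ(X)ᵒᵖ` vanishes. -/
def zeros (φ : (Lambda X)ᵒᵈ) : Opens X :=
  ⟨{x | (OrderDual.ofDual φ).1 x = Two.zero}, continuous_two_iff.1 (OrderDual.ofDual φ).1.continuous⟩

theorem zeros_le_zeros {φ χ : (Lambda X)ᵒᵈ} : zeros φ ≤ zeros χ ↔ φ ≤ χ := by
  change (∀ x, (OrderDual.ofDual φ).1 x = Two.zero → (OrderDual.ofDual χ).1 x = Two.zero) ↔
    ∀ x, (OrderDual.ofDual χ).1 x = Two.one → (OrderDual.ofDual φ).1 x = Two.one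
  refine forall_congr' fun x => ?_
  rw [← ne_one_iff, ← ne_one_iff]
  tauto

/-- The left adjoint map `X → 2` given by an open set of a completely distributive space. -/
noncomputable def lambdaInterior (U : Opens X) {S : C(Presheaf X, X)} {t : C(X, Presheaf X)}
    (ht : TopAdj t S) : (Lambda X)ᵒᵈ :=
  OrderDual.toDual
    ⟨{ toFun := fun x => truth (¬ ∀ a, t x a = Two.one → (U : Set X) ∈ a.ultra)
       continuous_toFun := by
         rw [continuous_two_iff]
         simp only [truth_eq_zero, not_not]
         exact (isOpen_forall_mem (U : Set X)).preimage t.continuous },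
      twoMap (S (openPresheaf U U.isOpen)) (S (ContinuousMap.const _ Two.one))
        (Specializes.map (presheaf_specializes_iff.2 fun _ _ => rfl) S.continuous),
      { unit := fun x => by
          change x ⤳ twoMap _ _ _ (truth _)
          by_cases h : ∀ a, t x a = Two.one → (U : Set X) ∈ a.ultra
          · rw [truth_eq_zero.2 (not_not.2 h)]
            refine (ht.specializes_iff _ _).1 (presheaf_specializes_iff.2 fun a ha => ?_)
            exact truth_eq_one.2 (h a ha)
          · rw [truth_eq_one.2 h]
            exact (ht.specializes_iff _ _).1 (presheaf_specializes_iff.2 fun _ _ => rfl)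
        counit := fun b => by
          rw [two_specializes_iff]
          intro hb
          cases b
          · refine absurd ?_ (truth_eq_one.1 hb)
            intro a ha
            exact truth_eq_one.1 (presheaf_specializes_iff.1 (ht.counit _) a ha)
          · rfl }⟩

theorem mem_zeros_lambdaInterior {U : Opens X} {S : C(Presheaf X, X)} {t : C(X, Presheaf X)}
    (ht : TopAdj t S) {x : X} :
    x ∈ zeros (lambdaInterior U ht) ↔ ∀ a, t x a = Two.one → (U : Set X) ∈ a.ultra :=
  truth_eq_zero.trans not_not

theorem pure_conv (x : X) : yoneda X x (show TopDual X from (pure x : Ultrafilter X)) = Two.one :=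
  yoneda_eq_one.2 (pure_le_nhds x)

theorem lambdaInterior_le_iff {U : Opens X} {S : C(Presheaf X, X)} {t : C(X, Presheaf X)}
    (hS : TopAdj S (yoneda X)) (ht : TopAdj t S) (φ : (Lambda X)ᵒᵈ) :
    lambdaInterior U ht ≤ φ ↔ U ≤ zeros φ := by
  rw [← zeros_le_zeros]
  have hff : ∀ x y : X, yoneda X x ⤳ yoneda X y → x ⤳ y := fun x y h =>
    specializes_iff_pure.2 (yoneda_eq_one.1 (presheaf_specializes_iff.1 h _ (pure_conv x)))
  have hty : ∀ x, t x ⤳ yoneda X x := fun x =>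
    (ht.specializes_iff _ _).2 (hff _ _ (hS.unit _))
  constructor
  · intro h x hx
    refine h ((mem_zeros_lambdaInterior ht).2 fun a ha => ?_)
    have := yoneda_eq_one.1 (presheaf_specializes_iff.1 (hty x) a ha)
    exact this (U.isOpen.mem_nhds hx)
  · intro h x hx
    rw [mem_zeros_lambdaInterior] at hx
    obtain ⟨r, hr⟩ := (OrderDual.ofDual φ).2
    have key : t x ⤳ yoneda X (r Two.zero) := by
      refine presheaf_specializes_iff.2 fun a ha => yoneda_eq_one.2 ?_
      intro V hV
      obtain ⟨W, hWV, hW, hrW⟩ := mem_nhds_iff.1 hV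
      refine Filter.mem_of_superset (hx a ha) fun y hy => hWV ?_
      refine Specializes.mem_open ((hr.specializes_iff y Two.zero).1 ?_) hW hrW
      exact specializes_of_eq (h hy)
    have hxr : x ⤳ r Two.zero := ((ht.specializes_iff _ _).1 key).trans (hS.counit _)
    have := two_specializes_iff.1 ((hr.specializes_iff _ _).2 hxr)
    refine ne_one_iff.1 fun h1 => ?_
    exact Two.noConfusion (this h1)

/-- For a completely distributive space `X`, `Λ(X)ᵒᵖ` is reflective in the frame of opens. -/
noncomputable def lambdaInsertion {S : C(Presheaf X, X)} {t : C(X, Presheaf X)}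
    (hS : TopAdj S (yoneda X)) (ht : TopAdj t S) :
    GaloisInsertion (fun U : Opens X => lambdaInterior U ht) zeros where
  choice U _ := lambdaInterior U ht
  gc _ φ := lambdaInterior_le_iff hS ht φ
  le_l_u φ := by
    rw [← zeros_le_zeros]
    exact GaloisConnection.le_u_l (fun _ φ => lambdaInterior_le_iff hS ht φ) (zeros φ)
  choice_eq _ _ := rfl

theorem lambdaInterior_inf {S : C(Presheaf X, X)} {t : C(X, Presheaf X)} (ht : TopAdj t S)
    (U V : Opens X) :
    zeros (lambdaInterior (U ⊓ V) ht) =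
      zeros (lambdaInterior U ht) ⊓ zeros (lambdaInterior V ht) := by
  ext x
  change x ∈ zeros _ ↔ x ∈ zeros _ ∧ x ∈ zeros _
  simp only [mem_zeros_lambdaInterior]
  exact ⟨fun h => ⟨fun a ha => Filter.mem_of_superset (h a ha) Set.inter_subset_left,
    fun a ha => Filter.mem_of_superset (h a ha) Set.inter_subset_right⟩,
    fun h a ha => Filter.inter_mem (h.1 a ha) (h.2 a ha)⟩

/-- For a completely distributive space `X`, the ordered set `Λ(X)ᵒᵖ` is a frame. -/
noncomputable abbrev lambdaFrame (hX : IsCompletelyDistributive X) : Order.Frame (Lambda X)ᵒᵈ :=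
  letI := (lambdaInsertion hX.choose_spec.1 hX.choose_spec.2.choose_spec).liftCompleteLattice
  Order.Frame.ofMinimalAxioms
    { inf_sSup_le_iSup_inf := fun φ s => by
        have gi := lambdaInsertion hX.choose_spec.1 hX.choose_spec.2.choose_spec
        rw [← zeros_le_zeros, gi.gc.u_inf]
        have h1 : sSup s = lambdaInterior (sSup (zeros '' s)) hX.choose_spec.2.choose_spec := rfl
        rw [h1]
        refine (inf_le_inf_right _ (gi.gc.le_u_l (zeros φ))).trans ?_
        rw [← lambdaInterior_inf]
        refine gi.gc.monotone_u (gi.gc.l_le ?_)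
        rw [inf_sSup_eq]
        refine iSup₂_le ?_
        rintro _ ⟨χ, hχ, rfl⟩
        rw [← gi.gc.u_inf]
        exact gi.gc.monotone_u (le_iSup₂ (f := fun b _ => φ ⊓ b) χ hχ) }

/-- Composition with a left adjoint map `g : Y → X`. -/
def lambdaComp (g : C(Y, X)) (hg : ∃ f : C(X, Y), TopAdj g f) (φ : (Lambda X)ᵒᵈ) :
    (Lambda Y)ᵒᵈ :=
  OrderDual.toDual ⟨(OrderDual.ofDual φ).1.comp g, by
    obtain ⟨f, hf⟩ := hg
    obtain ⟨r, hr⟩ := (OrderDual.ofDual φ).2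
    exact ⟨f.comp r, hf.comp hr⟩⟩

theorem zeros_injective : Function.Injective (zeros (X := X)) := fun _ _ h =>
  le_antisymm (zeros_le_zeros.1 h.le) (zeros_le_zeros.1 h.ge)

theorem zeros_inf (hX : IsCompletelyDistributive X) (φ χ : (Lambda X)ᵒᵈ) :
    letI := lambdaFrame hX
    zeros (φ ⊓ χ) = zeros φ ⊓ zeros χ :=
  letI := lambdaFrame hX
  (lambdaInsertion hX.choose_spec.1 hX.choose_spec.2.choose_spec).gc.u_inf

theorem zeros_top (hX : IsCompletelyDistributive X) :
    letI := lambdaFrame hX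
    zeros (⊤ : (Lambda X)ᵒᵈ) = ⊤ :=
  letI := lambdaFrame hX
  (lambdaInsertion hX.choose_spec.1 hX.choose_spec.2.choose_spec).gc.u_top

end Lambda

/-! ## The categories and functors -/

/-- Objects of the category of frames and finite-meet-preserving maps. -/
structure FrmInf : Type (u + 1) where
  carrier : Type u
  [frame : Order.Frame carrier]

attribute [instance] FrmInf.frame

/-- The category of frames and maps preserving finite meets (including the top element). -/
instance : Category FrmInf.{u} where
  Hom L M := InfTopHom L.carrier M.carrier
  id L := InfTopHom.id L.carrier
  comp f g := InfTopHom.comp g f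

/-- Objects of the category of completely distributive T₀ spaces. -/
structure CDTopInf : Type (u + 1) where
  carrier : Type u
  [top : TopologicalSpace carrier]
  [t0 : T0Space carrier]
  cd : IsCompletelyDistributive carrier

attribute [instance] CDTopInf.top CDTopInf.t0

/-- The right adjoint continuous maps. -/
@[ext]
structure CDTopInf.Hom (X Y : CDTopInf.{u}) : Type u where
  map : C(X.carrier, Y.carrier)
  exists_left : ∃ g : C(Y.carrier, X.carrier), TopAdj g map

/-- The category of completely distributive T₀ spaces and right adjoint continuous maps. -/
instance : Category CDTopInf.{u} where
  Hom X Y := CDTopInf.Hom X Y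
  id X := ⟨ContinuousMap.id _, ContinuousMap.id _, ⟨fun _ => specializes_rfl,
    fun _ => specializes_rfl⟩⟩
  comp f g := ⟨g.map.comp f.map, by
    obtain ⟨f', hf⟩ := f.exists_left
    obtain ⟨g', hg⟩ := g.exists_left
    exact ⟨f'.comp g', hg.comp hf⟩⟩

/-- The left adjoint of a morphism. -/
noncomputable def CDTopInf.Hom.left {X Y : CDTopInf.{u}} (f : CDTopInf.Hom X Y) :
    C(Y.carrier, X.carrier) :=
  f.exists_left.choose

theorem CDTopInf.Hom.left_adj {X Y : CDTopInf.{u}} (f : CDTopInf.Hom X Y) :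
    TopAdj f.left f.map :=
  f.exists_left.choose_spec

/-- The filter space functor. -/
def F : FrmInf.{u} ⥤ CDTopInf.{u} where
  obj L :=
    { carrier := Order.PFilter L.carrier
      cd := filter_isCompletelyDistributive L.carrier }
  map f := ⟨filterMap f, filterComap f, filterComap_adj_filterMap f⟩
  map_id L := CDTopInf.Hom.ext (filterMap_id L.carrier)
  map_comp f g := CDTopInf.Hom.ext (filterMap_comp g f)

/-- The functor sending `X` to `Λ(X)ᵒᵖ`, and a right adjoint `f : X → Y` to composition with the
left adjoint of `f`. -/
noncomputable def Pt : CDTopInf.{u} ⥤ FrmInf.{u} where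
  obj X :=
    { carrier := (Lambda X.carrier)ᵒᵈ
      frame := lambdaFrame X.cd }
  map {X Y} f :=
    letI := lambdaFrame X.cd
    letI := lambdaFrame Y.cd
    { toFun := lambdaComp f.left ⟨f.map, f.left_adj⟩
      map_inf' := fun φ χ => zeros_injective <| by
        rw [zeros_inf Y.cd]
        ext y
        have h := zeros_inf X.cd φ χ
        exact iff_of_eq (congrArg (fun U : Opens X.carrier => f.left y ∈ U) h)
      map_top' := zeros_injective <| by
        rw [zeros_top Y.cd]
        ext y
        have h := zeros_top X.cd
        exact iff_of_eq (congrArg (fun U : Opens X.carrier => f.left y ∈ U) h) }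
  map_id X := by
    let := lambdaFrame X.cd
    refine InfTopHom.ext (α := (Lambda X.carrier)ᵒᵈ) (β := (Lambda X.carrier)ᵒᵈ) fun φ => ?_
    have h : CDTopInf.Hom.left (𝟙 X) = ContinuousMap.id _ :=
      (CDTopInf.Hom.left_adj (𝟙 X)).left_unique
        ⟨fun _ => specializes_rfl, fun _ => specializes_rfl⟩
    refine zeros_injective ?_
    ext x
    change (OrderDual.ofDual φ).1 (CDTopInf.Hom.left (𝟙 X) x) = Two.zero ↔ _
    rw [h]
    rfl
  map_comp {X Y Z} f g := by
    let := lambdaFrame X.cd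
    let := lambdaFrame Z.cd
    refine InfTopHom.ext (α := (Lambda X.carrier)ᵒᵈ) (β := (Lambda Z.carrier)ᵒᵈ) fun φ => ?_
    have h : CDTopInf.Hom.left (f ≫ g) = (CDTopInf.Hom.left f).comp (CDTopInf.Hom.left g) :=
      (CDTopInf.Hom.left_adj (f ≫ g)).left_unique (g.left_adj.comp f.left_adj)
    refine zeros_injective ?_
    ext x
    change (OrderDual.ofDual φ).1 (CDTopInf.Hom.left (f ≫ g) x) = Two.zero ↔ _
    rw [h]
    rfl

end FilterDuality

namespace FilterDuality

open Order

/-! ## Generalities on adjoint continuous maps -/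

section Adjunctions

variable {X : Type u} {Y : Type v} [TopologicalSpace X] [TopologicalSpace Y]

/-! Everything rests on `toFilter` and `ofFilter`, which identify `Presheaf X` with the filter space
of the frame `Opens X`; under them Yoneda sends a point to its filter of open neighbourhoods.
Adjunctions between presheaf spaces thereby become adjunctions between finite-meet-preserving maps
of open sets.

Let `X` be completely distributive. If `φ` in `Lambda X` has right adjoint `r`, then `zeros φ` is
the least open neighbourhood of `r 0`. Such sets form a basis (`exists_mem_zeros_le`), so the
neighbourhood filter of `x` is generated by the `zeros φ` containing `x`, and its supremum gives `x`
back. Conversely, a filter `G` on `(Lambda X)ᵒᵈ` is recovered from its supremum, which lies in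
`zeros φ` exactly when `φ ∈ G` (`ofFilterSpace_mem_zeros_iff`). Hence `X` is equivalent to the
filter space of `(Lambda X)ᵒᵈ`, homeomorphic to it if `X` is T₀. As filter spaces of frames are
completely distributive and this property is invariant under equivalence, the characterisation
follows.

For the categories, this comparison is natural and makes `F` essentially surjective. `F` is full and
faithful because the principal filters are the points with a least open neighbourhood: a right
adjoint map preserves them, and so restricts to a map of frames (`exists_filterMap_eq`). -/

theorem TopAdj.right_unique [T0Space X] {f : C(X, Y)} {g g' : C(Y, X)} (h : TopAdj f g)
    (h' : TopAdj f g') : g = g' := by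
  ext y
  refine Inseparable.eq (Specializes.antisymm ?_ ?_)
  · exact (h'.specializes_iff _ _).1 (h.counit y)
  · exact (h.specializes_iff _ _).1 (h'.counit y)

theorem TopAdj.of_inseparable {f : C(X, Y)} {g : C(Y, X)} (h : ∀ x, Inseparable (g (f x)) x)
    (h' : ∀ y, Inseparable (f (g y)) y) : TopAdj f g :=
  ⟨fun x => (h x).specializes', fun y => (h' y).specializes⟩

/-- The principal ultrafilter at `x` converges to `x`, so an open set belonging to every ultrafilter
that converges to `x` contains `x`. -/
theorem mem_toFilter_yoneda {x : X} {U : Opens X} : U ∈ toFilter X (yoneda X x) ↔ x ∈ U := by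
  simp only [mem_toFilter, yoneda_eq_one]
  exact ⟨fun h => h (pure x : Ultrafilter X) (pure_le_nhds x),
    fun h a ha => ha (U.isOpen.mem_nhds h)⟩

/-- The Yoneda embedding reflects the underlying order. -/
theorem specializes_of_yoneda {x y : X} (h : yoneda X x ⤳ yoneda X y) : x ⤳ y :=
  specializes_iff_pure.2 (yoneda_eq_one.1 (presheaf_specializes_iff.1 h _ (pure_conv x)))

/-- A left adjoint of an order-reflecting map is a left inverse up to order equivalence. `X` need
not be T₀, so inseparability is the most one can get. -/
theorem inseparable_sup_yoneda {S : C(Presheaf X, X)} (hS : TopAdj S (yoneda X)) (x : X) :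
    Inseparable (S (yoneda X x)) x :=
  (hS.counit x).antisymm (specializes_of_yoneda (hS.unit _))

/-! ## Complete distributivity is invariant under equivalence -/

/-- The inverse image map of open sets as a homomorphism of meet-semilattices. -/
def opensComap (f : C(X, Y)) : InfTopHom (Opens Y) (Opens X) where
  toFun := Opens.comap f
  map_inf' _ _ := rfl
  map_top' := rfl

/-- Open sets are down-closed for `⤳`, so the unit and counit of `g ⊣ f` become inclusions between
an open set and its double inverse image. -/
theorem filterMap_opensComap_adj {f : C(X, Y)} {g : C(Y, X)} (h : TopAdj g f) :
    TopAdj (filterMap (opensComap g)) (filterMap (opensComap f)) where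
  unit F := by
    rw [filter_specializes_iff]
    rintro U ⟨V, ⟨W, hW, hWV⟩, hVU⟩
    refine PFilter.mem_of_le (fun x hx => hVU (hWV ?_)) hW
    exact (h.counit x).mem_open W.isOpen hx
  counit G := by
    rw [filter_specializes_iff]
    intro V hV
    exact ⟨opensComap f V, ⟨V, hV, le_rfl⟩, fun y hy =>
      (h.unit y).mem_open V.isOpen hy⟩

/-- An equivalence is an adjunction in both directions, and so is the map it induces on presheaf
spaces. Conjugating `S` and `t` by these maps gives the structure on `X`. -/
theorem isCompletelyDistributive_of_topEquivalent (h : TopEquivalent X Y)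
    (hY : IsCompletelyDistributive Y) : IsCompletelyDistributive X := by
  obtain ⟨f, g, hgf, hfg⟩ := h
  obtain ⟨S, hS, t, ht⟩ := hY
  have adj : TopAdj f g := TopAdj.of_inseparable hgf hfg
  have adj' : TopAdj g f := TopAdj.of_inseparable hfg hgf
  have hP : TopAdj ((ofFilter Y).comp ((filterMap (opensComap g)).comp (toFilter X)))
      ((ofFilter X).comp ((filterMap (opensComap f)).comp (toFilter Y))) :=
    (toFilter_adj.comp (filterMap_opensComap_adj adj')).comp ofFilter_adj
  have hP' : TopAdj ((ofFilter X).comp ((filterMap (opensComap f)).comp (toFilter Y)))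
      ((ofFilter Y).comp ((filterMap (opensComap g)).comp (toFilter X))) :=
    (toFilter_adj.comp (filterMap_opensComap_adj adj)).comp ofFilter_adj
  -- This is an equality even without T₀: points are compared through their open neighbourhoods,
  -- which do not distinguish `x` from `g (f x)`.
  have hy : yoneda X = ((ofFilter X).comp ((filterMap (opensComap f)).comp (toFilter Y))).comp
      ((yoneda Y).comp f) := by
    refine ContinuousMap.ext fun x => ?_
    rw [← ofFilter_toFilter (yoneda X x)]
    refine congrArg (ofFilter X) (SetLike.ext fun U => ?_)
    refine mem_toFilter_yoneda.trans ⟨fun hx => ?_, ?_⟩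
    · refine ⟨opensComap g U, mem_toFilter_yoneda.2 ?_, fun z hz => ?_⟩
      · exact (hgf x).specializes.mem_open U.isOpen hx
      · exact (hgf z).specializes'.mem_open U.isOpen hz
    · rintro ⟨V, hV, hVU⟩
      exact hVU (mem_toFilter_yoneda (x := f x).1 hV)
  refine ⟨(g.comp S).comp ((ofFilter Y).comp ((filterMap (opensComap g)).comp (toFilter X))),
    ?_, ((ofFilter X).comp ((filterMap (opensComap f)).comp (toFilter Y))).comp (t.comp f), ?_⟩
  · rw [hy]
    exact hP.comp (hS.comp adj')
  · exact (adj.comp ht).comp hP'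

end Adjunctions

/-! ## A completely distributive space is the filter space of the frame `Λ(X)ᵒᵖ` -/

section Representation

variable {X : Type u} [TopologicalSpace X]

/-- The frame `Λ(X)ᵒᵖ` of a completely distributive space. -/
noncomputable def lambdaFrm (hX : IsCompletelyDistributive X) : FrmInf.{u} where
  carrier := (Lambda X)ᵒᵈ
  frame := lambdaFrame hX

/-- The inclusion of `Λ(X)ᵒᵖ` into the frame of open sets. -/
noncomputable def zerosHom (hX : IsCompletelyDistributive X) :
    InfTopHom (lambdaFrm hX).carrier (Opens X) where
  toFun := zeros
  map_inf' := zeros_inf hX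
  map_top' := zeros_top hX

/-- The comparison map sending `x` to the filter of all `φ` that vanish at `x`. -/
noncomputable def toFilterSpace (hX : IsCompletelyDistributive X) :
    C(X, PFilter (lambdaFrm hX).carrier) :=
  (filterComap (zerosHom hX)).comp ((toFilter X).comp (yoneda X))

theorem mem_toFilterSpace {hX : IsCompletelyDistributive X} {x : X} {φ : (Lambda X)ᵒᵈ} :
    (show (lambdaFrm hX).carrier from φ) ∈ toFilterSpace hX x ↔ x ∈ zeros φ :=
  mem_toFilter_yoneda

/-- The inverse of the comparison map, which sends a filter to its supremum. -/
noncomputable def ofFilterSpace (hX : IsCompletelyDistributive X) :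
    C(PFilter (lambdaFrm hX).carrier, X) :=
  hX.choose.comp ((ofFilter X).comp (filterMap (zerosHom hX)))

/-- The open sets `zeros φ` with `φ ∈ Λ(X)` form a basis of a completely distributive space. -/
theorem exists_mem_zeros_le {S : C(Presheaf X, X)} {t : C(X, Presheaf X)}
    (hS : TopAdj S (yoneda X)) (ht : TopAdj t S) {x : X} {U : Opens X} (hx : x ∈ U) :
    ∃ φ : (Lambda X)ᵒᵈ, x ∈ zeros φ ∧ zeros φ ≤ U := by
  have hU : IsOpen ((S.comp (ofFilter X)) ⁻¹' (U : Set X)) :=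
    U.isOpen.preimage (S.comp (ofFilter X)).continuous
  -- The supremum of the neighbourhood filter of `x` is inseparable from `x`, hence in `U`. By
  -- continuity some open `V` containing `x` has the property that every filter containing `V` has
  -- its supremum in `U`.
  obtain ⟨V, hV, hVU⟩ := isOpen_filters_iff.1 hU (toFilter X (yoneda X x)) (by
    change S (ofFilter X (toFilter X (yoneda X x))) ∈ U
    rw [ofFilter_toFilter]
    exact (inseparable_sup_yoneda hS x).specializes.mem_open U.isOpen hx)
  refine ⟨lambdaInterior V ht, ?_, fun z hz => ?_⟩
  · exact (lambdaInsertion hS ht).gc.le_u_l V (mem_toFilter_yoneda.1 hV)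
  · have hm : S (openPresheaf V V.isOpen) ∈ U := by
      have := hVU (show toFilter X (openPresheaf V V.isOpen) ∈ sharp V from
        fun a ha => truth_eq_one.1 ha)
      change S (ofFilter X (toFilter X (openPresheaf V V.isOpen))) ∈ U at this
      rwa [ofFilter_toFilter] at this
    refine Specializes.mem_open ((ht.specializes_iff _ _).1 ?_) U.isOpen hm
    exact presheaf_specializes_iff.2 fun a ha =>
      truth_eq_one.2 ((mem_zeros_lambdaInterior ht).1 hz a ha)

theorem ofFilterSpace_toFilterSpace (hX : IsCompletelyDistributive X) (x : X) :
    Inseparable (ofFilterSpace hX (toFilterSpace hX x)) x := by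
  have hS := hX.choose_spec.1
  have ht := hX.choose_spec.2.choose_spec
  -- The sets `zeros φ` form a basis, so those containing `x` generate its whole neighbourhood
  -- filter.
  have key : filterMap (zerosHom hX) (toFilterSpace hX x) = toFilter X (yoneda X x) := by
    refine SetLike.ext fun U => Iff.trans ⟨?_, fun hU => ?_⟩ mem_toFilter_yoneda.symm
    · rintro ⟨φ, hφ, hU⟩
      exact hU (mem_toFilterSpace.1 hφ)
    · obtain ⟨φ, hφ, hle⟩ := exists_mem_zeros_le hS ht hU
      exact ⟨φ, mem_toFilterSpace.2 hφ, hle⟩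
  change Inseparable (hX.choose (ofFilter X (filterMap (zerosHom hX) (toFilterSpace hX x)))) x
  rw [key, ofFilter_toFilter]
  exact inseparable_sup_yoneda hS x

/-- Membership in `zeros φ` means lying below `r 0`. By `Sup ⊣ yoneda`, a filter of opens has its
supremum below `r 0` iff it contains every open neighbourhood of `r 0`, that is, iff it contains the
least one, `zeros φ`. -/
theorem ofFilterSpace_mem_zeros_iff (hX : IsCompletelyDistributive X)
    (G : PFilter (lambdaFrm hX).carrier) (φ : (Lambda X)ᵒᵈ) :
    ofFilterSpace hX G ∈ zeros φ ↔ (show (lambdaFrm hX).carrier from φ) ∈ G := by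
  have hS := hX.choose_spec.1
  obtain ⟨r, hr⟩ := (OrderDual.ofDual φ).2
  have hz : ∀ x, x ∈ zeros φ ↔ x ⤳ r Two.zero := fun x => by
    rw [← hr.specializes_iff, two_specializes_iff]
    change _ = Two.zero ↔ (_ = Two.one → Two.zero = Two.one)
    rw [← ne_one_iff]
    simp
  have key : filterMap (zerosHom hX) G ≥ toFilter X (yoneda X (r Two.zero)) ↔
      (show (lambdaFrm hX).carrier from φ) ∈ G := by
    constructor
    · intro h
      obtain ⟨χ, hχ, hle⟩ := h (mem_toFilter_yoneda.2 ((hz _).2 specializes_rfl))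
      exact PFilter.mem_of_le (zeros_le_zeros.1 hle) hχ
    · intro hφ U hU
      refine ⟨φ, hφ, fun x hx => ?_⟩
      exact ((hz x).1 hx).mem_open U.isOpen (mem_toFilter_yoneda.1 hU)
  rw [hz, ← key, ge_iff_le, ← filter_specializes_iff]
  exact (hS.specializes_iff _ _).trans (ofFilter_adj.specializes_iff _ _)

theorem toFilterSpace_ofFilterSpace (hX : IsCompletelyDistributive X)
    (G : PFilter (lambdaFrm hX).carrier) : toFilterSpace hX (ofFilterSpace hX G) = G :=
  SetLike.ext fun φ => mem_toFilterSpace.trans (ofFilterSpace_mem_zeros_iff hX G φ)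

theorem topEquivalent_filterSpace (hX : IsCompletelyDistributive X) :
    TopEquivalent X (PFilter (lambdaFrm hX).carrier) :=
  ⟨toFilterSpace hX, ofFilterSpace hX, ofFilterSpace_toFilterSpace hX,
    fun G => .of_eq (toFilterSpace_ofFilterSpace hX G)⟩

/-- Morphisms of `CDTopInf` must have left adjoints; being mutually inverse, the two comparison maps
are left adjoint to each other. -/
theorem toFilterSpace_adj (hX : IsCompletelyDistributive X) :
    TopAdj (toFilterSpace hX) (ofFilterSpace hX) :=
  TopAdj.of_inseparable (ofFilterSpace_toFilterSpace hX)
    fun G => .of_eq (toFilterSpace_ofFilterSpace hX G)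

theorem ofFilterSpace_adj (hX : IsCompletelyDistributive X) :
    TopAdj (ofFilterSpace hX) (toFilterSpace hX) :=
  TopAdj.of_inseparable (fun G => .of_eq (toFilterSpace_ofFilterSpace hX G))
    (ofFilterSpace_toFilterSpace hX)

end Representation

/-! ## The equivalence of categories -/

/-- A completely distributive T₀ space is naturally isomorphic to the filter space of
`Λ(X)ᵒᵖ`. -/
noncomputable def ptFilterIso : Pt.{u} ⋙ F.{u} ≅ 𝟭 CDTopInf.{u} :=
  NatIso.ofComponents
    (fun X =>
      { hom := ⟨ofFilterSpace X.cd, toFilterSpace X.cd, toFilterSpace_adj X.cd⟩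
        inv := ⟨toFilterSpace X.cd, ofFilterSpace X.cd, ofFilterSpace_adj X.cd⟩
        hom_inv_id := CDTopInf.Hom.ext <| ContinuousMap.ext <| toFilterSpace_ofFilterSpace X.cd
        inv_hom_id := CDTopInf.Hom.ext <| ContinuousMap.ext fun x =>
          (ofFilterSpace_toFilterSpace X.cd x).eq })
    (fun {X Y} f => by
      -- Naturality is checked on left adjoints, where both sides send `y` to the filter of those
      -- `φ` vanishing at `f.left y`. Right adjoints into a T₀ space are unique.
      have h : (filterComap (Pt.map f)).comp (toFilterSpace Y.cd) =
          (toFilterSpace X.cd).comp f.left := by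
        refine ContinuousMap.ext fun y => SetLike.ext fun φ => ?_
        refine (mem_toFilterSpace (hX := Y.cd) (φ := lambdaComp f.left ⟨f.map, f.left_adj⟩ φ)).trans
          (mem_toFilterSpace (hX := X.cd) (x := f.left y) (φ := φ)).symm
      have h₁ := (toFilterSpace_adj Y.cd).comp (filterComap_adj_filterMap (Pt.map f))
      have h₂ := f.left_adj.comp (toFilterSpace_adj X.cd)
      rw [← h] at h₂
      exact CDTopInf.Hom.ext (h₁.right_unique h₂))

/-! ### Full faithfulness of `F` through principal filters -/

theorem filterMap_principal {L : Type u} {M : Type v} [SemilatticeInf L] [OrderTop L]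
    [SemilatticeInf M] [OrderTop M] (f : InfTopHom L M) (x : L) :
    filterMap f (PFilter.principal x) = PFilter.principal (f x) := by
  refine SetLike.ext fun y =>
    mem_filterMap.trans ⟨?_, fun hy => ⟨x, PFilter.mem_principal.2 le_rfl, hy⟩⟩
  rintro ⟨z, hz, hy⟩
  exact (OrderHomClass.mono f (PFilter.mem_principal.1 hz)).trans hy

theorem principal_le_iff {L : Type u} [SemilatticeInf L] [OrderTop L] {x : L} {G : PFilter L} :
    PFilter.principal x ≤ G ↔ x ∈ G :=
  ⟨fun h => h le_rfl, fun h _ hy => PFilter.mem_of_le hy h⟩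

/-- The principal filters are the points with a least open neighbourhood. -/
theorem exists_eq_principal {L : Type u} [SemilatticeInf L] [OrderTop L] {G : PFilter L}
    (hG : IsOpen {H : PFilter L | G ≤ H}) : ∃ x, G = PFilter.principal x := by
  obtain ⟨x, hx, h⟩ := isOpen_filters_iff.1 hG G (le_refl G)
  exact ⟨x, le_antisymm (h (show x ∈ PFilter.principal x from le_rfl)) (principal_le_iff.2 hx)⟩

/-- Every right adjoint map of filter spaces is induced by a meet-preserving map. -/
theorem exists_filterMap_eq {L : Type u} {M : Type v} [SemilatticeInf L] [OrderTop L]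
    [SemilatticeInf M] [OrderTop M] {g : C(PFilter M, PFilter L)} {h : C(PFilter L, PFilter M)}
    (hgh : TopAdj g h) : ∃ f : InfTopHom L M, filterMap f = h := by
  have hmem : ∀ (x : L) (G : PFilter M), x ∈ g G ↔ h (PFilter.principal x) ≤ G := fun x G => by
    rw [← principal_le_iff, ← filter_specializes_iff, hgh.specializes_iff, filter_specializes_iff]
  -- The filters above `h (principal x)` form the inverse image of `sharp x` under `g`, which is
  -- open; so `h (principal x)` has a least open neighbourhood.
  have hex : ∀ x : L, ∃ y : M, h (PFilter.principal x) = PFilter.principal y := fun x =>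
    exists_eq_principal <| by
      simp only [← hmem]
      exact (isOpen_sharp x).preimage g.continuous
  choose f hf using hex
  have hfmem : ∀ (x : L) (G : PFilter M), f x ∈ G ↔ x ∈ g G := fun x G => by
    rw [hmem, hf, principal_le_iff]
  -- Filters separate the elements of `M`, so identities for `f` can be tested by membership in the
  -- filters `g G`, where they are the filter axioms.
  have hext : ∀ {a b : M}, (∀ G : PFilter M, a ∈ G ↔ b ∈ G) → a = b := fun {a b} hab =>
    le_antisymm ((hab (PFilter.principal a)).1 le_rfl) ((hab (PFilter.principal b)).2 le_rfl)
  let f' : InfTopHom L M :=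
    { toFun := f
      map_inf' := fun x y => hext fun G => by
        rw [hfmem, PFilter.inf_mem_iff, PFilter.inf_mem_iff, hfmem, hfmem]
      map_top' := hext fun G => by
        rw [hfmem]
        exact iff_of_true PFilter.top_mem PFilter.top_mem }
  have hg : filterComap f' = g :=
    ContinuousMap.ext fun G => SetLike.ext fun x => hfmem x G
  exact ⟨f', (hg ▸ filterComap_adj_filterMap f' : TopAdj g (filterMap f')).right_unique hgh⟩

instance : F.{u}.Faithful where
  map_injective {L M} f f' h := by
    refine InfTopHom.ext (α := L.carrier) (β := M.carrier) fun x => ?_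
    have h' : filterMap f = filterMap f' := congrArg CDTopInf.Hom.map h
    have hx := DFunLike.congr_fun h' (PFilter.principal x)
    rw [filterMap_principal, filterMap_principal] at hx
    exact le_antisymm (principal_le_iff.1 hx.ge) (principal_le_iff.1 hx.le)

instance : F.{u}.Full where
  map_surjective h := by
    obtain ⟨g, hg⟩ := h.exists_left
    obtain ⟨f, hf⟩ := exists_filterMap_eq hg
    exact ⟨f, CDTopInf.Hom.ext hf⟩

instance : F.{u}.EssSurj where
  mem_essImage X := ⟨Pt.obj X, ⟨ptFilterIso.app X⟩⟩

instance : F.{u}.IsEquivalence where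

/-- The functors `F` and `Pt` form an equivalence of categories. -/
noncomputable def filterEquivalence : FrmInf.{u} ≌ CDTopInf.{u} :=
  -- The quasi-inverse supplied by choice is isomorphic to `Pt`, since `Pt ⋙ F ≅ 𝟭`; replacing it
  -- makes the inverse equal to `Pt` on the nose.
  F.asEquivalence.changeInverse <|
    (Functor.leftUnitor _).symm ≪≫ Functor.isoWhiskerRight ptFilterIso.symm _ ≪≫
      Functor.associator _ _ _ ≪≫ Functor.isoWhiskerLeft Pt F.asEquivalence.unitIso.symm ≪≫
      Functor.rightUnitor _

end FilterDuality

theorem mainTheorem4 :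
    (∃ e : FilterDuality.FrmInf.{u} ≌ FilterDuality.CDTopInf.{u},
      e.functor = FilterDuality.F ∧ e.inverse = FilterDuality.Pt) ∧
    ∀ (X : Type u) [TopologicalSpace X],
      (∃ L : FilterDuality.FrmInf.{u},
        FilterDuality.TopEquivalent X (Order.PFilter L.carrier)) ↔
      FilterDuality.IsCompletelyDistributive X := by
  refine ⟨⟨FilterDuality.filterEquivalence, rfl, rfl⟩, fun X _ => ⟨?_, fun hX => ?_⟩⟩
  · rintro ⟨L, hL⟩
    exact FilterDuality.isCompletelyDistributive_of_topEquivalent hL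
      (FilterDuality.filter_isCompletelyDistributive L.carrier)
  · exact ⟨FilterDuality.lambdaFrm hX, FilterDuality.topEquivalent_filterSpace hX⟩
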